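/- Let $\alpha\in(0,1)$, $T>0$, $R_0>0$, $n\in\mathbb N$, let $\|\cdot\|$ be the Euclidean norm on $\mathbb R^n$ and $B(r)=\{x\in\mathbb R^n:\|x\|\le r\}$. Let $f:[0,T]\times\mathbb R^n\to\mathbb R^n$ satisfy: 1. for every $x\in\mathbb R^n$, the function $f(\cdot,x)$ is (Lebesgue) measurable on $[0,T]$; 2. for every $r>0$ there is $\lambda_f>0$ with $\|f(t,x)-f(t,y)\|\le\lambda_f\|x-y\|$ for all $t\in[0,T]$ and $x,y\in B(r)$; 3. there is $c_f>0$ with $\|f(t,x)\|\le(1+\|x\|)c_f$ for all $t\in[0,T]$ and $x\in\mathbb R^n$. For $\varphi\in L^\infty([0,T],\mathbb R^n)$ put $$(I^\alpha\varphi)(t)=\frac1{\Gamma(\alpha)}\int_0^t\frac{\varphi(\tau)}{(t-\tau)^{1-\alpha}}\,d\tau,$$ and for $x:[0,T]\to\mathbb R^n$, $h>0$ and $\beta\in(0,1)$ put $$({}^CD^\alpha x)(t)=\frac1{\Gamma(1-\alpha)}\frac{d}{dt}\int_0^t\frac{x(\tau)-x(0)}{(t-\tau)^\alpha}\,d\tau,\qquad(\Delta_h^{\beta}x)(t)=\sum_{j=0}^{\lfloor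 t/h\rfloor}(-1)^j\binom{\beta}{j}x(t-jh).$$ For $x_0\in\mathbb R^n$ and $h>0$ consider the Cauchy problems $$\text{(A)}\quad({}^CD^\alpha x)(t)=f(t,x(t)),\ x(0)=x_0;\qquad\text{(B)}\quad\dot y(t)=f\bigl(t,\,x_0+h^{\alpha-1}(\Delta_h^{1-\alpha}y)(t)\bigr),\ y(0)=0.$$ A solution of (A) is a function $x:[0,T]\to\mathbb R^n$ of the form $x=x_0+I^\alpha\varphi$ on $[0,T]$ with $\varphi\in L^\infty([0,T],\mathbb R^n)$ (so that $x(0)=x_0$) that satisfies the equation for almost every $t\in[0,T]$. A solution of (B) is a Lipschitz continuous function $y:[0,T]\to\mathbb R^n$ with $y(0)=0$ that satisfies the equation for almost every $t\in[0,T]$. **Theorem.** For every $\varepsilon>0$ there exists $h_*>0$ such that, for every $x_0\in B(R_0)$ and every $h\in(0,h_*]$, problem (A) has a unique solution $x$, problem (B) has a unique solution $y$, and $$\bigl\|x(t)-x_0-h^{\alpha-1}(\Delta_h^{1-\alpha}y)(t)\bigr\|\le\varepsilon\qquad\text{for all }t\in[0,T].$$ -/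

import Mathlib

open MeasureTheory Set

noncomputable section

variable {E : Type*} [NormedAddCommGroup E] [NormedSpace ℝ E]

/-- The left-sided Riemann–Liouville fractional integral of order `α`:
`(I^α φ)(t) = 1/Γ(α) ∫₀ᵗ φ(τ) / (t - τ)^(1-α) dτ`. -/
def rlIntegral (α : ℝ) (φ : ℝ → E) (t : ℝ) : E :=
  (1 / Real.Gamma α) • ∫ τ in (0 : ℝ)..t, (1 / (t - τ) ^ (1 - α)) • φ τ

/-- The function `t ↦ x t` on `[0, T]` belongs to `{x₀} + I^α(L^∞([0, T]))`. -/
def MemShiftedRLRange (α T : ℝ) (x₀ : E) (x : ℝ → E) : Prop :=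
  ∃ φ : ℝ → E, MemLp φ ⊤ (volume.restrict (Icc 0 T)) ∧
    ∀ t ∈ Icc 0 T, x t = x₀ + rlIntegral α φ t

/-- The left-sided Caputo derivative of order `α` of `x` at `t` exists and equals `v`:
`1/Γ(1-α) d/dt ∫₀ᵗ (x(τ) - x(0)) / (t - τ)^α dτ = v`. -/
def HasCaputoDerivAt (α : ℝ) (x : ℝ → E) (v : E) (t : ℝ) : Prop :=
  HasDerivAt (fun s : ℝ => (1 / Real.Gamma (1 - α)) •
    ∫ τ in (0 : ℝ)..s, (1 / (s - τ) ^ α) • (x τ - x 0)) v t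

/-- The left-sided fractional difference of order `α` with step `h`:
`(Δ_h^α x)(t) = ∑_{j=0}^{[t/h]} (-1)^j (α choose j) x(t - j h)`. -/
def fracDiff (α h : ℝ) (x : ℝ → E) (t : ℝ) : E :=
  ∑ j ∈ Finset.range (⌊t / h⌋₊ + 1), ((-1 : ℝ) ^ j * Ring.choose α j) • x (t - j * h)

/-- `x` is a solution on `[0, T]` of `(ᶜD^α x)(t) = f(t, x(t))`, `x(0) = x₀`: it lies in
`{x₀} + I^α(L^∞)` (which includes the initial condition), and the equation holds
for almost every `t ∈ [0, T]`. -/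
def IsCaputoSolution (α T : ℝ) (f : ℝ → E → E) (x₀ : E) (x : ℝ → E) : Prop :=
  MemShiftedRLRange α T x₀ x ∧
    ∀ᵐ t ∂(volume.restrict (Icc 0 T)), HasCaputoDerivAt α x (f t (x t)) t

/-- The value `x₀ + h^(α-1) (Δ_h^(1-α) y)(t)`. -/
def approxState (α h : ℝ) (x₀ : E) (y : ℝ → E) (t : ℝ) : E :=
  x₀ + h ^ (α - 1) • fracDiff (1 - α) h y t

/-- `y` is a solution on `[0, T]` of `ẏ(t) = f(t, x₀ + h^(α-1) (Δ_h^(1-α) y)(t))`, `y(0) = 0`: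
it is Lipschitz continuous on `[0, T]`, vanishes at `0`, and the equation holds for almost
every `t ∈ [0, T]`. -/
def IsApproxSolution (α T : ℝ) (f : ℝ → E → E) (x₀ : E) (h : ℝ) (y : ℝ → E) : Prop :=
  (∃ L : NNReal, LipschitzOnWith L y (Icc 0 T)) ∧ y 0 = 0 ∧
    ∀ᵐ t ∂(volume.restrict (Icc 0 T)), HasDerivAt y (f t (approxState α h x₀ y t)) t

end

open Filter Topology


/-! Both Cauchy problems are one Volterra equation `z = x₀ + ∫₀ᵗ k(t - s) f(s, z(s)) ds` with
different kernels. For (A), `I^(1-α) I^α = I¹` shows that the Caputo derivative of `x₀ + I^α φ` is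
`φ` a.e., so `k(u) = u^(α-1)/Γ(α)` (`isCaputoSolution_iff`). For (B), writing `y` as the integral of
its derivative `ψ` and summing the shifted integrals turns `h^(α-1) Δ_h^(1-α) y` into the
convolution of `ψ` with the step kernel `h^(α-1) c_⌊u/h⌋`, where `c_m` are the partial sums of the
binomial coefficients of `(1 - q)^(1-α)` (`fracDiff_integral_eq_volterra`).

These partial sums are the coefficients of `(1 - q)^(-α)`, hence `c_m = α(α+1)⋯(α+m-1)/m!`, and
Euler's limit for `Γ` gives `c_m ~ m^(α-1)/Γ(α)`. So the step kernels tend pointwise to the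
fractional one under a common integrable majorant, and therefore in `L¹(0, T)`
(`tendsto_integral_abs_rlKernel_sub`).

The Volterra equation is treated in the norm `sup ‖z(t)‖ e^(-γt)`: the operator norm is at most `∫
|k| e^(-γu)`, which is small for large `γ`. One weight, fitted to the growth constant, confines all
solutions to a ball; a second, fitted to the Lipschitz constant on that ball, gives existence,
uniqueness and stability in the kernel (`IsVolterraSolution.norm_sub_le`). The weights fit all small
`h` at once, and only the bound `R₀` on the initial value enters, so `h_*` does not depend on `x₀`.
-/

theorem exists_ae_norm_le_of_memLp_top {E : Type*} [NormedAddCommGroup E] {φ : ℝ → E}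
    {μ : Measure ℝ} (hφ : MemLp φ ⊤ μ) :
    ∃ C : ℝ, 0 ≤ C ∧ ∀ᵐ s ∂μ, ‖φ s‖ ≤ C := by
  refine ⟨(eLpNormEssSup φ μ).toReal, ENNReal.toReal_nonneg, ?_⟩
  have h := hφ.2
  rw [eLpNorm_exponent_top] at h
  filter_upwards [enorm_ae_le_eLpNormEssSup φ μ] with s hs
  have := ENNReal.toReal_mono h.ne hs
  simpa using this

/-! ### Linear Volterra operators and exponentially weighted bounds -/

section Volterra

variable {E : Type*} [NormedAddCommGroup E] [NormedSpace ℝ E]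

/-- The Volterra convolution operator `(V_k φ)(t) = ∫₀ᵗ k(t - s) φ(s) ds`. -/
noncomputable def volterra (k : ℝ → ℝ) (φ : ℝ → E) (t : ℝ) : E :=
  ∫ s in (0 : ℝ)..t, k (t - s) • φ s

/-- `z` solves `z = x₀ + V_k f(·, z(·))` on `[0, T]` with an essentially bounded right-hand side. -/
def IsVolterraSolution (k : ℝ → ℝ) (T : ℝ) (f : ℝ → E → E) (x₀ : E) (z : ℝ → E) : Prop :=
  ∃ φ : ℝ → E, MemLp φ ⊤ (volume.restrict (Icc 0 T)) ∧
    (∀ t ∈ Icc 0 T, z t = x₀ + volterra k φ t) ∧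
    φ =ᵐ[volume.restrict (Icc 0 T)] fun t => f t (z t)

variable {k : ℝ → ℝ} {T : ℝ} {t : ℝ}

theorem Ioc_subset_Icc_of_mem (ht : t ∈ Icc 0 T) : Ioc 0 t ⊆ Icc 0 T :=
  fun _ hs => ⟨hs.1.le, hs.2.trans ht.2⟩

theorem intervalIntegrable_comp_sub_left_of_mem (hk : IntervalIntegrable k volume 0 T)
    (ht : t ∈ Icc 0 T) : IntervalIntegrable (fun s => k (t - s)) volume 0 t := by
  have h1 : IntervalIntegrable k volume 0 t := by
    refine hk.mono_set ?_
    rw [uIcc_of_le ht.1, uIcc_of_le (ht.1.trans ht.2)]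
    exact Icc_subset_Icc_right ht.2
  simpa using (h1.comp_sub_left t).symm

theorem intervalIntegrable_volterra (hk : IntervalIntegrable k volume 0 T) {φ : ℝ → E}
    (hφ : MemLp φ ⊤ (volume.restrict (Icc 0 T))) (ht : t ∈ Icc 0 T) :
    IntervalIntegrable (fun s => k (t - s) • φ s) volume 0 t := by
  have h1 := intervalIntegrable_comp_sub_left_of_mem hk ht
  rw [intervalIntegrable_iff_integrableOn_Ioc_of_le ht.1] at h1 ⊢
  exact h1.smul_of_top_left (hφ.mono_measure (Measure.restrict_mono_set _ (Ioc_subset_Icc_of_mem ht)))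

theorem volterra_congr_ae {φ ψ : ℝ → E} (h : φ =ᵐ[volume.restrict (Icc 0 T)] ψ)
    (ht : t ∈ Icc 0 T) : volterra k φ t = volterra k ψ t := by
  unfold volterra
  rw [intervalIntegral.integral_of_le ht.1, intervalIntegral.integral_of_le ht.1]
  refine integral_congr_ae ?_
  have h' := ae_mono (Measure.restrict_mono_set volume (Ioc_subset_Icc_of_mem ht)) h
  filter_upwards [h'] with s hs
  rw [hs]

theorem volterra_sub (hk : IntervalIntegrable k volume 0 T) {φ ψ : ℝ → E}
    (hφ : MemLp φ ⊤ (volume.restrict (Icc 0 T))) (hψ : MemLp ψ ⊤ (volume.restrict (Icc 0 T)))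
    (ht : t ∈ Icc 0 T) :
    volterra k (fun s => φ s - ψ s) t = volterra k φ t - volterra k ψ t := by
  unfold volterra
  rw [← intervalIntegral.integral_sub (intervalIntegrable_volterra hk hφ ht)
    (intervalIntegrable_volterra hk hψ ht)]
  simp only [smul_sub]

theorem volterra_kernel_sub {k' : ℝ → ℝ} (hk : IntervalIntegrable k volume 0 T)
    (hk' : IntervalIntegrable k' volume 0 T) {φ : ℝ → E}
    (hφ : MemLp φ ⊤ (volume.restrict (Icc 0 T))) (ht : t ∈ Icc 0 T) :
    volterra (fun u => k u - k' u) φ t = volterra k φ t - volterra k' φ t := by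
  unfold volterra
  rw [← intervalIntegral.integral_sub (intervalIntegrable_volterra hk hφ ht)
    (intervalIntegrable_volterra hk' hφ ht)]
  simp only [sub_smul]

/-- Weighted bound for the Volterra operator. -/
theorem norm_volterra_le (hk : IntervalIntegrable k volume 0 T) {φ : ℝ → E} {γ C q : ℝ}
    (hC : 0 ≤ C) (hφ : ∀ᵐ s ∂(volume.restrict (Icc 0 T)), ‖φ s‖ ≤ C * Real.exp (γ * s))
    (hq : ∫ u in (0 : ℝ)..T, |k u| * Real.exp (-γ * u) ≤ q) (ht : t ∈ Icc 0 T) :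
    ‖volterra k φ t‖ ≤ C * q * Real.exp (γ * t) := by
  have hexp : ∀ c : ℝ, Continuous fun u : ℝ => Real.exp (c * u) := fun c => by fun_prop
  have hkT : IntervalIntegrable (fun u => |k u| * Real.exp (-γ * u)) volume 0 T :=
    hk.abs.mul_continuousOn (hexp _).continuousOn
  have h1 : ‖volterra k φ t‖ ≤ ∫ s in (0 : ℝ)..t, |k (t - s)| * (C * Real.exp (γ * s)) := by
    refine intervalIntegral.norm_integral_le_of_norm_le ht.1 ?_ ?_
    · have h' := (ae_restrict_iff' measurableSet_Icc).1 hφ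
      filter_upwards [h'] with s hs hst
      rw [norm_smul, Real.norm_eq_abs]
      exact mul_le_mul_of_nonneg_left (hs (Ioc_subset_Icc_of_mem ht hst)) (abs_nonneg _)
    · exact (intervalIntegrable_comp_sub_left_of_mem hk ht).abs.mul_continuousOn
        (continuousOn_const.mul (hexp _).continuousOn)
  -- Substitute `u = t - s` and split `e^(γs) = e^(γt) e^(-γu)`: the weight moves onto the kernel.
  have h2 : ∫ s in (0 : ℝ)..t, |k (t - s)| * (C * Real.exp (γ * s)) =
      C * Real.exp (γ * t) * ∫ u in (0 : ℝ)..t, |k u| * Real.exp (-γ * u) := by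
    have := intervalIntegral.integral_comp_sub_left (a := 0) (b := t)
      (fun u => C * Real.exp (γ * t) * (|k u| * Real.exp (-γ * u))) t
    rw [sub_self, sub_zero] at this
    rw [← intervalIntegral.integral_const_mul, ← this]
    refine intervalIntegral.integral_congr fun s _ => ?_
    have : Real.exp (γ * s) = Real.exp (γ * t) * Real.exp (-γ * (t - s)) := by
      rw [← Real.exp_add]; ring_nf
    simp only [this]; ring
  have h3 : ∫ u in (0 : ℝ)..t, |k u| * Real.exp (-γ * u) ≤ q := by
    refine le_trans ?_ hq
    refine intervalIntegral.integral_mono_interval le_rfl ht.1 ht.2 ?_ hkT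
    exact Eventually.of_forall fun u => by positivity
  rw [h2] at h1
  calc ‖volterra k φ t‖ ≤ _ := h1
    _ ≤ C * Real.exp (γ * t) * q := by gcongr
    _ = _ := by ring

/-- The integrand, cut off to `0 < s ≤ t`, is jointly measurable once `φ` is replaced by a strongly
measurable version, so its integral over `s` is measurable in `t`. This keeps the successive
approximations measurable. -/
theorem aestronglyMeasurable_volterra (hk : Measurable k) {φ : ℝ → E}
    (hφ : AEStronglyMeasurable φ (volume.restrict (Icc 0 T))) :
    AEStronglyMeasurable (volterra k φ) (volume.restrict (Icc 0 T)) := by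
  obtain ⟨ψ, hψ, hφψ⟩ := hφ
  have hset : MeasurableSet {p : ℝ × ℝ | p.2 ∈ Ioc 0 p.1} :=
    (measurableSet_lt measurable_const measurable_snd).inter
      (measurableSet_le measurable_snd measurable_fst)
  have hm : StronglyMeasurable (fun p : ℝ × ℝ =>
      {p : ℝ × ℝ | p.2 ∈ Ioc 0 p.1}.indicator (fun p => k (p.1 - p.2) • ψ p.2) p) := by
    refine StronglyMeasurable.indicator ?_ hset
    exact (hk.comp (measurable_fst.sub measurable_snd)).stronglyMeasurable.smul
      (hψ.comp_measurable measurable_snd)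
  refine ⟨_, hm.integral_prod_right' (ν := volume), ?_⟩
  filter_upwards [ae_restrict_mem measurableSet_Icc] with t ht
  rw [volterra_congr_ae hφψ ht, volterra, intervalIntegral.integral_of_le ht.1,
    ← integral_indicator measurableSet_Ioc]
  rfl

/-- A Gronwall-type inequality: if every weighted bound `d ≤ C e^{γt}` improves to
`d ≤ (A + C / 2) e^{γt}`, then `d ≤ 2 A e^{γt}`. -/
theorem le_two_mul_exp_of_forall_improve {d : ℝ → ℝ} {γ A : ℝ} (hγ : 0 ≤ γ) (hd : ∀ t, 0 ≤ d t)
    (hbd : ∃ M, ∀ t ∈ Icc 0 T, d t ≤ M)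
    (h : ∀ C, 0 ≤ C → (∀ t ∈ Icc 0 T, d t ≤ C * Real.exp (γ * t)) →
      ∀ t ∈ Icc 0 T, d t ≤ (A + C / 2) * Real.exp (γ * t)) (ht : t ∈ Icc 0 T) :
    d t ≤ 2 * A * Real.exp (γ * t) := by
  obtain ⟨M, hM⟩ := hbd
  set g : ℝ → ℝ := fun t => d t * Real.exp (-(γ * t)) with hg
  have hgd : ∀ t C, g t ≤ C ↔ d t ≤ C * Real.exp (γ * t) := fun t C => by
    rw [hg]; simp only [Real.exp_neg]
    rw [← div_eq_mul_inv, div_le_iff₀ (Real.exp_pos _)]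
  have hne : (g '' Icc 0 T).Nonempty := ⟨_, mem_image_of_mem g ht⟩
  have hbdd : BddAbove (g '' Icc 0 T) := by
    refine ⟨M, ?_⟩
    rintro _ ⟨s, hs, rfl⟩
    rw [hgd]
    have := hM s hs
    have h1 : 1 ≤ Real.exp (γ * s) := Real.one_le_exp (mul_nonneg hγ hs.1)
    nlinarith [hd s]
  set S := sSup (g '' Icc 0 T) with hS
  have hle : ∀ s ∈ Icc 0 T, g s ≤ S := fun s hs => le_csSup hbdd (mem_image_of_mem g hs)
  have hS0 : 0 ≤ S := le_trans (mul_nonneg (hd t) (Real.exp_pos _).le) (hle t ht)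
  -- The supremum `S` is itself an admissible `C`; being finite, it can be absorbed, giving `S ≤
  -- 2A`.
  have hS2 : S ≤ A + S / 2 := by
    refine csSup_le hne ?_
    rintro _ ⟨s, hs, rfl⟩
    rw [hgd]
    exact h S hS0 (fun r hr => (hgd r S).1 (hle r hr)) s hs
  rw [← hgd]
  linarith [hle t ht]

theorem volterra_bounded (hk : IntervalIntegrable k volume 0 T) {φ : ℝ → E}
    (hφ : MemLp φ ⊤ (volume.restrict (Icc 0 T))) :
    ∃ M : ℝ, ∀ t ∈ Icc 0 T, ‖volterra k φ t‖ ≤ M := by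
  obtain ⟨C, hC, hφC⟩ := exists_ae_norm_le_of_memLp_top hφ
  refine ⟨C * ∫ u in (0 : ℝ)..T, |k u| * Real.exp (-0 * u), fun t ht => ?_⟩
  simpa using norm_volterra_le (γ := 0) hk hC (by simpa using hφC) le_rfl ht

end Volterra

/-! ### The nonlinear Volterra equation: a priori bound, stability, existence -/

section Nonlinear

variable {E : Type*} [NormedAddCommGroup E]

theorem continuous_of_lipschitz_on_balls {g : E → E}
    (hg : ∀ r : ℝ, 0 < r → ∃ lam : ℝ, 0 < lam ∧ ∀ x ∈ Metric.closedBall (0 : E) r,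
      ∀ y ∈ Metric.closedBall (0 : E) r, ‖g x - g y‖ ≤ lam * ‖x - y‖) : Continuous g := by
  refine continuous_iff_continuousAt.2 fun x => ?_
  obtain ⟨lam, hlam, h⟩ := hg (‖x‖ + 1) (by positivity)
  have hL : LipschitzOnWith ⟨lam, hlam.le⟩ g (Metric.closedBall (0 : E) (‖x‖ + 1)) :=
    LipschitzOnWith.of_dist_le_mul fun y hy z hz => by
      rw [dist_eq_norm, dist_eq_norm]; exact h y hy z hz
  refine hL.continuousOn.continuousAt ?_
  refine mem_of_superset (Metric.ball_mem_nhds x one_pos) fun y hy => ?_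
  rw [Metric.mem_ball, dist_eq_norm] at hy
  rw [mem_closedBall_zero_iff]
  calc ‖y‖ = ‖x + (y - x)‖ := by congr 1; abel
    _ ≤ ‖x‖ + ‖y - x‖ := norm_add_le _ _
    _ ≤ _ := by linarith

/-- Superposition with a Carathéodory function preserves measurability. -/
theorem aestronglyMeasurable_superposition [MeasurableSpace E] [BorelSpace E]
    [SecondCountableTopology E] {f : ℝ → E → E} {S : Set ℝ} (hS : MeasurableSet S)
    (hf_meas : ∀ x, AEMeasurable (fun t => f t x) (volume.restrict S))
    (hf_cont : ∀ t ∈ S, Continuous (f t)) {z : ℝ → E}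
    (hz : AEStronglyMeasurable z (volume.restrict S)) :
    AEStronglyMeasurable (fun t => f t (z t)) (volume.restrict S) := by
  obtain ⟨ψ, hψ, hzψ⟩ := hz
  -- For a simple function the superposition is a finite sum of the `f(·, c)` restricted to level
  -- sets; continuity in the state then passes to the limit.
  have hsimple : ∀ s : SimpleFunc ℝ E,
      AEMeasurable (fun t => f t (s t)) (volume.restrict S) := fun s => by
    have : (fun t => f t (s t)) =
        fun t => ∑ c ∈ s.range, (s ⁻¹' {c}).indicator (fun t => f t c) t := by
      ext t
      rw [Finset.sum_eq_single (s t)]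
      · rw [indicator_of_mem]; rfl
      · intro c _ hc
        exact indicator_of_notMem (fun h => hc h.symm) _
      · exact fun h => absurd (s.mem_range_self t) h
    rw [this]
    exact Finset.aemeasurable_fun_sum _ fun c _ => (hf_meas c).indicator (s.measurableSet_fiber c)
  have hlim : AEMeasurable (fun t => f t (ψ t)) (volume.restrict S) := by
    refine aemeasurable_of_tendsto_metrizable_ae atTop (fun n => hsimple (hψ.approx n)) ?_
    filter_upwards [ae_restrict_mem hS] with t ht
    exact ((hf_cont t ht).tendsto _).comp (hψ.tendsto_approx t)
  refine hlim.aestronglyMeasurable.congr ?_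
  filter_upwards [hzψ] with t ht
  rw [ht]

variable [NormedSpace ℝ E] {k : ℝ → ℝ} {T : ℝ} {f : ℝ → E → E} {x₀ : E} {z : ℝ → E}
  {c lam R γ γ' : ℝ}

theorem IsVolterraSolution.eq_volterra (hz : IsVolterraSolution k T f x₀ z) {t : ℝ}
    (ht : t ∈ Icc 0 T) : z t = x₀ + volterra k (fun s => f s (z s)) t := by
  obtain ⟨φ, -, h1, h2⟩ := hz
  rw [h1 t ht, volterra_congr_ae h2 ht]

theorem IsVolterraSolution.memLp (hz : IsVolterraSolution k T f x₀ z) :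
    MemLp (fun s => f s (z s)) ⊤ (volume.restrict (Icc 0 T)) := by
  obtain ⟨φ, hφ, -, h2⟩ := hz
  exact (memLp_congr_ae h2).1 hφ

theorem IsVolterraSolution.bounded (hk : IntervalIntegrable k volume 0 T)
    (hz : IsVolterraSolution k T f x₀ z) : ∃ M : ℝ, ∀ t ∈ Icc 0 T, ‖z t‖ ≤ M := by
  obtain ⟨M, hM⟩ := volterra_bounded hk hz.memLp
  refine ⟨‖x₀‖ + M, fun t ht => ?_⟩
  rw [hz.eq_volterra ht]
  exact (norm_add_le _ _).trans (by linarith [hM t ht])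

/-- The threshold `1/(2c)` cancels the growth constant and leaves a factor `1/2`, the one that the
Gronwall-type inequality absorbs. -/
theorem norm_volterra_le_of_growth (hk : IntervalIntegrable k volume 0 T)
    (hc : 0 < c) (hf : ∀ t ∈ Icc 0 T, ∀ x, ‖f t x‖ ≤ (1 + ‖x‖) * c)
    (hq : ∫ u in (0 : ℝ)..T, |k u| * Real.exp (-γ * u) ≤ 1 / (2 * c)) {C : ℝ} (hC : 0 ≤ C)
    (hz : ∀ t ∈ Icc 0 T, 1 + ‖z t‖ ≤ C * Real.exp (γ * t)) {t : ℝ} (ht : t ∈ Icc 0 T) :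
    ‖volterra k (fun s => f s (z s)) t‖ ≤ C / 2 * Real.exp (γ * t) := by
  refine (norm_volterra_le (C := C * c) hk (by positivity) ?_ hq ht).trans (le_of_eq ?_)
  · filter_upwards [ae_restrict_mem measurableSet_Icc] with s hs
    calc ‖f s (z s)‖ ≤ (1 + ‖z s‖) * c := hf s hs _
      _ ≤ (C * Real.exp (γ * s)) * c := by gcongr; exact hz s hs
      _ = _ := by ring
  · field_simp

/-- A priori bound for solutions of the Volterra equation. -/
theorem IsVolterraSolution.one_add_norm_le (hk : IntervalIntegrable k volume 0 T)
    (hc : 0 < c) (hf : ∀ t ∈ Icc 0 T, ∀ x, ‖f t x‖ ≤ (1 + ‖x‖) * c) (hγ : 0 ≤ γ)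
    (hq : ∫ u in (0 : ℝ)..T, |k u| * Real.exp (-γ * u) ≤ 1 / (2 * c)) (hx₀ : ‖x₀‖ ≤ R)
    (hz : IsVolterraSolution k T f x₀ z) {t : ℝ} (ht : t ∈ Icc 0 T) :
    1 + ‖z t‖ ≤ 2 * (1 + R) * Real.exp (γ * t) := by
  refine le_two_mul_exp_of_forall_improve (d := fun t => 1 + ‖z t‖) hγ (fun t => by positivity)
    ?_ ?_ ht
  · obtain ⟨M, hM⟩ := hz.bounded hk
    exact ⟨1 + M, fun t ht => by linarith [hM t ht]⟩
  · intro C hC hzC t ht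
    have h1 := norm_volterra_le_of_growth hk hc hf hq hC hzC ht
    have h2 : 1 ≤ Real.exp (γ * t) := Real.one_le_exp (mul_nonneg hγ ht.1)
    have hR : 0 ≤ R := (norm_nonneg _).trans hx₀
    have h3 : ‖z t‖ ≤ ‖x₀‖ + ‖volterra k (fun s => f s (z s)) t‖ := by
      rw [hz.eq_volterra ht]; exact norm_add_le _ _
    nlinarith

/-- The integral operator is a contraction with factor `1/2` in the weighted norm, on functions with
values in the ball where `lam` is valid. -/
theorem norm_volterra_sub_le_of_lipschitz (hk : IntervalIntegrable k volume 0 T) {r C : ℝ}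
    (hlam : 0 < lam)
    (hf : ∀ t ∈ Icc 0 T, ∀ x ∈ Metric.closedBall (0 : E) r, ∀ y ∈ Metric.closedBall (0 : E) r,
      ‖f t x - f t y‖ ≤ lam * ‖x - y‖)
    (hq : ∫ u in (0 : ℝ)..T, |k u| * Real.exp (-γ * u) ≤ 1 / (2 * lam)) {w : ℝ → E}
    (hfz : MemLp (fun s => f s (z s)) ⊤ (volume.restrict (Icc 0 T)))
    (hfw : MemLp (fun s => f s (w s)) ⊤ (volume.restrict (Icc 0 T)))
    (hz : ∀ t ∈ Icc 0 T, ‖z t‖ ≤ r) (hw : ∀ t ∈ Icc 0 T, ‖w t‖ ≤ r) (hC : 0 ≤ C)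
    (h : ∀ t ∈ Icc 0 T, ‖z t - w t‖ ≤ C * Real.exp (γ * t)) {t : ℝ} (ht : t ∈ Icc 0 T) :
    ‖volterra k (fun s => f s (z s)) t - volterra k (fun s => f s (w s)) t‖ ≤
      C / 2 * Real.exp (γ * t) := by
  rw [← volterra_sub hk hfz hfw ht]
  refine (norm_volterra_le (C := C * lam) hk (by positivity) ?_ hq ht).trans
    (le_of_eq ?_)
  · filter_upwards [ae_restrict_mem measurableSet_Icc] with s hs
    calc ‖f s (z s) - f s (w s)‖ ≤ lam * ‖z s - w s‖ :=
          hf s hs _ (by simpa using hz s hs) _ (by simpa using hw s hs)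
      _ ≤ lam * (C * Real.exp (γ * s)) := by gcongr; exact h s hs
      _ = _ := by ring
  · field_simp

/-- Stability of the Volterra equation with respect to the kernel. -/
theorem IsVolterraSolution.norm_sub_le {k' : ℝ → ℝ} (hk : IntervalIntegrable k volume 0 T)
    (hk' : IntervalIntegrable k' volume 0 T) {r η : ℝ} (hc : 0 < c)
    (hf : ∀ t ∈ Icc 0 T, ∀ x, ‖f t x‖ ≤ (1 + ‖x‖) * c) (hlam : 0 < lam)
    (hf_lip : ∀ t ∈ Icc 0 T, ∀ x ∈ Metric.closedBall (0 : E) r,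
      ∀ y ∈ Metric.closedBall (0 : E) r, ‖f t x - f t y‖ ≤ lam * ‖x - y‖) (hγ : 0 ≤ γ)
    (hq : ∫ u in (0 : ℝ)..T, |k u| * Real.exp (-γ * u) ≤ 1 / (2 * lam)) {w : ℝ → E}
    (hz : IsVolterraSolution k T f x₀ z) (hw : IsVolterraSolution k' T f x₀ w)
    (hzr : ∀ t ∈ Icc 0 T, ‖z t‖ ≤ r) (hwr : ∀ t ∈ Icc 0 T, ‖w t‖ ≤ r) (hr : 0 ≤ r)
    (hη : ∫ u in (0 : ℝ)..T, |k u - k' u| ≤ η) {t : ℝ} (ht : t ∈ Icc 0 T) :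
    ‖z t - w t‖ ≤ 2 * ((1 + r) * c * η) * Real.exp (γ * t) := by
  refine le_two_mul_exp_of_forall_improve (d := fun t => ‖z t - w t‖) hγ
    (fun t => norm_nonneg _) ⟨2 * r, fun t ht => ?_⟩ ?_ ht
  · exact (_root_.norm_sub_le _ _).trans (by linarith [hzr t ht, hwr t ht])
  · intro C hC hzw t ht
    have h1 := norm_volterra_sub_le_of_lipschitz hk hlam hf_lip hq hz.memLp hw.memLp hzr hwr hC
      hzw ht
    have h2 : ‖volterra (fun u => k u - k' u) (fun s => f s (w s)) t‖ ≤ (1 + r) * c * η := by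
      have := norm_volterra_le (φ := fun s => f s (w s)) (γ := 0) (C := (1 + r) * c) (q := η)
        (hk.sub hk') (by positivity) ?_ (by simpa using hη) ht
      · simpa using this
      · filter_upwards [ae_restrict_mem measurableSet_Icc] with s hs
        simp only [zero_mul, Real.exp_zero, mul_one]
        refine (hf s hs _).trans ?_
        gcongr
        exact hwr s hs
    rw [volterra_kernel_sub hk hk' hw.memLp ht] at h2
    have h3 : 1 ≤ Real.exp (γ * t) := Real.one_le_exp (mul_nonneg hγ ht.1)
    -- Insert the old kernel applied to `f(·, w)`: the first difference is contracted, the second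
    -- sees only `k - k'`.
    have h4 : z t - w t =
        (volterra k (fun s => f s (z s)) t - volterra k (fun s => f s (w s)) t) +
        (volterra k (fun s => f s (w s)) t - volterra k' (fun s => f s (w s)) t) := by
      rw [hz.eq_volterra ht, hw.eq_volterra ht]; abel
    have h5 := norm_add_le
      (volterra k (fun s => f s (z s)) t - volterra k (fun s => f s (w s)) t)
      (volterra k (fun s => f s (w s)) t - volterra k' (fun s => f s (w s)) t)
    rw [← h4] at h5
    have h6 : (1 + r) * c * η ≤ (1 + r) * c * η * Real.exp (γ * t) := by
      have := (norm_nonneg _).trans h2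
      nlinarith
    calc ‖z t - w t‖ ≤ C / 2 * Real.exp (γ * t) + (1 + r) * c * η * Real.exp (γ * t) := by
          linarith
      _ = _ := by ring

/-- Existence for the Volterra equation by successive approximations. -/
theorem exists_isVolterraSolution [CompleteSpace E] [MeasurableSpace E] [BorelSpace E]
    [SecondCountableTopology E] (hk : IntervalIntegrable k volume 0 T) (hkm : Measurable k)
    (hf_meas : ∀ x, AEMeasurable (fun t => f t x) (volume.restrict (Icc 0 T)))
    (hf_cont : ∀ t ∈ Icc 0 T, Continuous (f t)) (hc : 0 < c)
    (hf : ∀ t ∈ Icc 0 T, ∀ x, ‖f t x‖ ≤ (1 + ‖x‖) * c) (hγ : 0 ≤ γ)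
    (hq : ∫ u in (0 : ℝ)..T, |k u| * Real.exp (-γ * u) ≤ 1 / (2 * c)) (hx₀ : ‖x₀‖ ≤ R)
    (hlam : 0 < lam)
    (hf_lip : ∀ t ∈ Icc 0 T, ∀ x ∈ Metric.closedBall (0 : E) (2 * (1 + R) * Real.exp (γ * T)),
      ∀ y ∈ Metric.closedBall (0 : E) (2 * (1 + R) * Real.exp (γ * T)),
        ‖f t x - f t y‖ ≤ lam * ‖x - y‖) (hγ' : 0 ≤ γ')
    (hq' : ∫ u in (0 : ℝ)..T, |k u| * Real.exp (-γ' * u) ≤ 1 / (2 * lam)) :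
    ∃ z : ℝ → E, IsVolterraSolution k T f x₀ z := by
  have hR : 0 ≤ R := (norm_nonneg _).trans hx₀
  set r := 2 * (1 + R) * Real.exp (γ * T) with hr
  set Z : ℕ → ℝ → E := fun n =>
    Nat.rec (fun _ => x₀) (fun _ w t => x₀ + volterra k (fun s => f s (w s)) t) n with hZ
  have hZs : ∀ n t, Z (n + 1) t = x₀ + volterra k (fun s => f s (Z n s)) t := fun n t => rfl
  have hexp : ∀ t ∈ Icc 0 T, 1 ≤ Real.exp (γ * t) := fun t ht =>
    Real.one_le_exp (mul_nonneg hγ ht.1)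
  -- The constant `2(1 + R)` reproduces itself: `1 + R` comes from the initial value and half of
  -- `2(1 + R)` from the integral. All iterates thus stay in the ball of radius `r`.
  have hbd : ∀ n, ∀ t ∈ Icc 0 T, 1 + ‖Z n t‖ ≤ 2 * (1 + R) * Real.exp (γ * t) := by
    intro n
    induction n with
    | zero => intro t ht; change 1 + ‖x₀‖ ≤ _; nlinarith [hexp t ht]
    | succ n ih =>
      intro t ht
      have h1 := norm_volterra_le_of_growth hk hc hf hq (by positivity) ih ht
      have h2 := norm_add_le x₀ (volterra k (fun s => f s (Z n s)) t)
      rw [← hZs] at h2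
      nlinarith [hexp t ht]
  have hr_of : ∀ w : ℝ → E, (∀ t ∈ Icc 0 T, 1 + ‖w t‖ ≤ 2 * (1 + R) * Real.exp (γ * t)) →
      ∀ t ∈ Icc 0 T, ‖w t‖ ≤ r := fun w hw t ht => by
    have : Real.exp (γ * t) ≤ Real.exp (γ * T) := by gcongr; exact ht.2
    have h2 : 2 * (1 + R) * Real.exp (γ * t) ≤ r := by rw [hr]; gcongr
    linarith [hw t ht]
  have hmemLp : ∀ w : ℝ → E, AEStronglyMeasurable w (volume.restrict (Icc 0 T)) →
      (∀ t ∈ Icc 0 T, ‖w t‖ ≤ r) →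
      MemLp (fun s => f s (w s)) ⊤ (volume.restrict (Icc 0 T)) := fun w hwm hw => by
    refine memLp_top_of_bound
      (aestronglyMeasurable_superposition measurableSet_Icc hf_meas hf_cont hwm) ((1 + r) * c) ?_
    filter_upwards [ae_restrict_mem measurableSet_Icc] with s hs
    refine (hf s hs _).trans ?_
    gcongr
    exact hw s hs
  have hZr : ∀ n, ∀ t ∈ Icc 0 T, ‖Z n t‖ ≤ r := fun n => hr_of _ (hbd n)
  have hZm : ∀ n, AEStronglyMeasurable (Z n) (volume.restrict (Icc 0 T)) := by
    intro n
    induction n with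
    | zero => exact aestronglyMeasurable_const
    | succ n ih =>
      exact aestronglyMeasurable_const.add
        (aestronglyMeasurable_volterra hkm (hmemLp _ ih (hZr n)).1)
  have hr0 : 0 ≤ r := by positivity
  have hdiff : ∀ n, ∀ t ∈ Icc 0 T,
      ‖Z (n + 1) t - Z n t‖ ≤ 2 * r / 2 ^ n * Real.exp (γ' * t) := by
    intro n
    induction n with
    | zero =>
      intro t ht
      have h1 : 1 ≤ Real.exp (γ' * t) := Real.one_le_exp (mul_nonneg hγ' ht.1)
      have := norm_sub_le (Z 1 t) (Z 0 t)
      have h2 := hZr 1 t ht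
      have h3 := hZr 0 t ht
      simp only [pow_zero, div_one, zero_add]
      nlinarith
    | succ n ih =>
      intro t ht
      have h1 := norm_volterra_sub_le_of_lipschitz hk hlam hf_lip hq'
        (hmemLp _ (hZm (n + 1)) (hZr (n + 1))) (hmemLp _ (hZm n) (hZr n)) (hZr (n + 1)) (hZr n)
        (by positivity) ih ht
      rw [hZs (n + 1), hZs n, add_sub_add_left_eq_sub]
      refine h1.trans (le_of_eq ?_)
      rw [pow_succ]; field_simp
  -- Total of the geometric majorants `2r/2^n · e^(γ'T)` of the increments, hence a bound for the
  -- distance from `Z 0` to the limit.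
  set D := 4 * r * Real.exp (γ' * T) with hD
  have hdist : ∀ t ∈ Icc 0 T, ∀ n, dist (Z n t) (Z (n + 1) t) ≤ D / 2 / 2 ^ n := by
    intro t ht n
    rw [dist_comm, dist_eq_norm]
    refine (hdiff n t ht).trans ?_
    have : Real.exp (γ' * t) ≤ Real.exp (γ' * T) := by gcongr; exact ht.2
    calc 2 * r / 2 ^ n * Real.exp (γ' * t) ≤ 2 * r / 2 ^ n * Real.exp (γ' * T) := by gcongr
      _ = _ := by rw [hD]; ring
  have hlim : ∀ t ∈ Icc 0 T, ∃ a, Tendsto (fun n => Z n t) atTop (𝓝 a) := fun t ht =>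
    cauchySeq_tendsto_of_complete (cauchySeq_of_le_geometric_two (hdist t ht))
  choose! z hz using hlim
  have hZz : ∀ n, ∀ t ∈ Icc 0 T, ‖Z n t - z t‖ ≤ D / 2 ^ n := fun n t ht => by
    rw [← dist_eq_norm]
    exact dist_le_of_le_geometric_two_of_tendsto (hdist t ht) (hz t ht) n
  have hzr : ∀ t ∈ Icc 0 T, ‖z t‖ ≤ r := fun t ht =>
    le_of_tendsto (hz t ht).norm (Eventually.of_forall fun n => hZr n t ht)
  have hzm : AEStronglyMeasurable z (volume.restrict (Icc 0 T)) := by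
    refine aestronglyMeasurable_of_tendsto_ae atTop hZm ?_
    filter_upwards [ae_restrict_mem measurableSet_Icc] with t ht using hz t ht
  have hfz := hmemLp z hzm hzr
  refine ⟨z, _, hfz, fun t ht => ?_, Filter.EventuallyEq.rfl⟩
  have hlim1 : Tendsto (fun n => Z (n + 1) t) atTop (𝓝 (z t)) :=
    (hz t ht).comp (tendsto_add_atTop_nat 1)
  -- The iterates converge uniformly at rate `D/2^n`, so the contraction estimate lets the limit
  -- pass under the integral.
  refine tendsto_nhds_unique hlim1 ?_
  simp only [hZs]
  refine Tendsto.const_add _ ?_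
  rw [tendsto_iff_norm_sub_tendsto_zero]
  have hD0 : Tendsto (fun n : ℕ => D / 2 ^ n / 2 * Real.exp (γ' * t)) atTop (𝓝 0) := by
    have : Tendsto (fun n : ℕ => D * Real.exp (γ' * t) / 2 * (1 / 2 : ℝ) ^ n) atTop
        (𝓝 (D * Real.exp (γ' * t) / 2 * 0)) :=
      (tendsto_pow_atTop_nhds_zero_of_lt_one (by norm_num) (by norm_num)).const_mul _
    rw [mul_zero] at this
    refine this.congr fun n => ?_
    rw [one_div, inv_pow]; ring
  refine squeeze_zero (fun n => norm_nonneg _) (fun n => ?_) hD0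
  refine norm_volterra_sub_le_of_lipschitz hk hlam hf_lip hq' (hmemLp _ (hZm n) (hZr n)) hfz
    (hZr n) hzr (by positivity) (fun s hs => ?_) ht
  have h1 : 1 ≤ Real.exp (γ' * s) := Real.one_le_exp (mul_nonneg hγ' hs.1)
  have h2 : 0 ≤ D / 2 ^ n := by positivity
  nlinarith [hZz n s hs]

end Nonlinear

/-! ### The fractional kernel and its step approximations -/

section Kernels

/-- The kernel `u ↦ u^(α-1) / Γ(α)` of the Riemann–Liouville integral of order `α`. -/
noncomputable def rlKernel (α u : ℝ) : ℝ := (1 / Real.Gamma α) * (1 / u ^ (1 - α))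

/-- The partial sums of the binomial coefficients of `(1 - q)^(1 - α)`. -/
noncomputable def fracCoeff (α : ℝ) (m : ℕ) : ℝ :=
  ∑ j ∈ Finset.range (m + 1), (-1 : ℝ) ^ j * Ring.choose (1 - α) j

/-- The kernel of the operator `ψ ↦ h^(α-1) Δ_h^(1-α) I¹ψ`. -/
noncomputable def approxKernel (α h u : ℝ) : ℝ := h ^ (α - 1) * fracCoeff α ⌊u / h⌋₊

variable {α T : ℝ}

theorem succ_mul_ringChoose_succ (r : ℝ) (j : ℕ) :
    ((j : ℝ) + 1) * Ring.choose r (j + 1) = Ring.choose r j * (r - j) := by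
  have := Ring.choose_smul_choose r (Nat.le_succ j)
  simpa using this

/-- Coefficient form of `d/dq (1-q)^(1-α) = (α-1)(1-q)^(-α)`, since partial summation is division by
`1 - q`. It yields the one-step recursion for `fracCoeff`. -/
theorem binomial_succ_eq_fracCoeff (α : ℝ) (m : ℕ) :
    (-1 : ℝ) ^ (m + 1) * Ring.choose (1 - α) (m + 1) * (m + 1) = (α - 1) * fracCoeff α m := by
  induction m with
  | zero => simp [fracCoeff]
  | succ m ih =>
    have h1 := succ_mul_ringChoose_succ (1 - α) (m + 1)
    have h2 : fracCoeff α (m + 1) =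
        fracCoeff α m + (-1 : ℝ) ^ (m + 1) * Ring.choose (1 - α) (m + 1) :=
      Finset.sum_range_succ _ _
    rw [h2]
    push_cast at h1 ⊢
    rw [pow_succ]
    linear_combination (-(-1 : ℝ) ^ (m + 1)) * h1 + ih

theorem fracCoeff_succ (α : ℝ) (m : ℕ) :
    fracCoeff α (m + 1) * (m + 1) = fracCoeff α m * (α + m) := by
  have h1 := binomial_succ_eq_fracCoeff α m
  have h2 : fracCoeff α (m + 1) =
      fracCoeff α m + (-1 : ℝ) ^ (m + 1) * Ring.choose (1 - α) (m + 1) :=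
    Finset.sum_range_succ _ _
  rw [h2]
  linear_combination h1

theorem fracCoeff_eq_prod (α : ℝ) (m : ℕ) :
    fracCoeff α m * m.factorial = ∏ j ∈ Finset.range m, (α + j) := by
  induction m with
  | zero => simp [fracCoeff]
  | succ m ih =>
    rw [Finset.prod_range_succ, ← ih, Nat.factorial_succ]
    push_cast
    linear_combination (m.factorial : ℝ) * fracCoeff_succ α m

theorem fracCoeff_pos (hα : 0 < α) (m : ℕ) : 0 < fracCoeff α m := by
  have h1 : 0 < fracCoeff α m * m.factorial := by
    rw [fracCoeff_eq_prod]
    exact Finset.prod_pos fun j _ => by positivity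
  exact pos_of_mul_pos_left h1 (by positivity)

/-- By the product formula, `fracCoeff α m` is, up to factors tending to 1, `m^(α-1)` divided by the
`m`-th term of Euler's sequence for `Γ(α)`. Using `m + 1` in place of `m` makes the bound usable at
`m = 0` too. -/
theorem tendsto_fracCoeff_mul_rpow (hα : 0 < α) :
    Tendsto (fun m : ℕ => fracCoeff α m * (m + 1 : ℝ) ^ (1 - α)) atTop
      (𝓝 (1 / Real.Gamma α)) := by
  have h1 : Tendsto (fun m : ℕ => (m : ℝ) / (m + α)) atTop (𝓝 1) :=
    tendsto_natCast_div_add_atTop α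
  have h2 : Tendsto (fun m : ℕ => (1 + 1 / (m : ℝ)) ^ (1 - α)) atTop (𝓝 1) := by
    have : Tendsto (fun m : ℕ => 1 + 1 / (m : ℝ)) atTop (𝓝 (1 + 0)) :=
      tendsto_one_div_atTop_nhds_zero_nat.const_add 1
    have h := this.rpow_const (p := 1 - α) (Or.inl (by norm_num))
    simpa using h
  have h3 := ((h1.mul h2).div (Real.GammaSeq_tendsto_Gamma α) (Real.Gamma_pos_of_pos hα).ne')
  rw [mul_one] at h3
  refine h3.congr' ?_
  filter_upwards [eventually_gt_atTop 0] with m hm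
  have hm' : (0 : ℝ) < m := by exact_mod_cast hm
  have hp : (m : ℝ) + α ≠ 0 := by positivity
  have hf := (fracCoeff_pos hα m).ne'
  have hfac : (m.factorial : ℝ) ≠ 0 := by positivity
  simp only [Pi.div_apply, Real.GammaSeq]
  rw [Finset.prod_range_succ, ← fracCoeff_eq_prod]
  have e1 : (1 + 1 / (m : ℝ)) = (m + 1) / m := by field_simp
  rw [e1, Real.div_rpow (by positivity) hm'.le, Real.rpow_sub hm', Real.rpow_one]
  have hma : (m : ℝ) ^ α ≠ 0 := (Real.rpow_pos_of_pos hm' α).ne'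
  rw [add_comm α (m : ℝ)]
  field_simp

theorem exists_fracCoeff_le (hα : 0 < α) :
    ∃ C : ℝ, 0 ≤ C ∧ ∀ m : ℕ, fracCoeff α m * (m + 1 : ℝ) ^ (1 - α) ≤ C := by
  obtain ⟨C, hC⟩ := (tendsto_fracCoeff_mul_rpow hα).bddAbove_range
  have h : ∀ m : ℕ, fracCoeff α m * (m + 1 : ℝ) ^ (1 - α) ≤ C := fun m => hC ⟨m, rfl⟩
  refine ⟨C, le_trans ?_ (h 0), h⟩
  have := (fracCoeff_pos hα 0).le
  positivity

/-- Separates a bounded factor, convergent as `⌊u/h⌋ → ∞`, from a power of the grid point just to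
the right of `u`. That point exceeds `u` and is at most `u + h`, so the negative power is dominated
by `u^(α-1)` and converges to it. -/
theorem approxKernel_eq {h u : ℝ} (hh : 0 < h) :
    approxKernel α h u = fracCoeff α ⌊u / h⌋₊ * ((⌊u / h⌋₊ : ℝ) + 1) ^ (1 - α) *
      (h * (⌊u / h⌋₊ + 1)) ^ (α - 1) := by
  have hp : (0 : ℝ) < (⌊u / h⌋₊ : ℝ) + 1 := by positivity
  have e : ((⌊u / h⌋₊ : ℝ) + 1) ^ (1 - α) * ((⌊u / h⌋₊ : ℝ) + 1) ^ (α - 1) = 1 := by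
    rw [← Real.rpow_add hp]; simp
  rw [approxKernel, Real.mul_rpow hh.le hp.le]
  linear_combination (-(h ^ (α - 1) * fracCoeff α ⌊u / h⌋₊)) * e

theorem lt_mul_floor_add_one {h : ℝ} (hh : 0 < h) (u : ℝ) : u < h * (⌊u / h⌋₊ + 1) := by
  have := Nat.lt_floor_add_one (u / h)
  rw [div_lt_iff₀ hh] at this
  linarith

theorem tendsto_approxKernel (hα : 0 < α) {u : ℝ} (hu : 0 < u) :
    Tendsto (fun h => approxKernel α h u) (𝓝[>] 0) (𝓝 (rlKernel α u)) := by
  have hfl : Tendsto (fun h : ℝ => ⌊u / h⌋₊) (𝓝[>] 0) atTop :=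
    tendsto_nat_floor_atTop.comp (tendsto_inv_nhdsGT_zero.const_mul_atTop hu)
  have h1 := (tendsto_fracCoeff_mul_rpow hα).comp hfl
  have h0 : Tendsto (fun h : ℝ => u + h) (𝓝[>] 0) (𝓝 u) := by
    have : Tendsto (fun h : ℝ => u + h) (𝓝 0) (𝓝 (u + 0)) := tendsto_id.const_add u
    rw [add_zero] at this
    exact this.mono_left nhdsWithin_le_nhds
  have h2 : Tendsto (fun h : ℝ => h * ((⌊u / h⌋₊ : ℝ) + 1)) (𝓝[>] 0) (𝓝 u) := by
    refine tendsto_of_tendsto_of_tendsto_of_le_of_le' tendsto_const_nhds h0 ?_ ?_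
    · filter_upwards [self_mem_nhdsWithin] with h hh using (lt_mul_floor_add_one hh u).le
    · filter_upwards [self_mem_nhdsWithin] with h hh
      have hh' : 0 < h := hh
      have := Nat.floor_le (a := u / h) (by positivity)
      rw [le_div_iff₀ hh'] at this
      linarith
  have h3 := h1.mul (h2.rpow_const (p := α - 1) (Or.inl hu.ne'))
  have e : rlKernel α u = 1 / Real.Gamma α * u ^ (α - 1) := by
    rw [rlKernel, one_div (u ^ _), ← Real.rpow_neg hu.le, neg_sub]
  rw [e]
  refine h3.congr' ?_
  filter_upwards [self_mem_nhdsWithin] with h hh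
  rw [approxKernel_eq hh]; rfl

theorem abs_approxKernel_le (hα : α ∈ Ioo (0 : ℝ) 1) {C : ℝ}
    (hC : ∀ m : ℕ, fracCoeff α m * (m + 1 : ℝ) ^ (1 - α) ≤ C) {h u : ℝ} (hh : 0 < h)
    (hu : 0 < u) : |approxKernel α h u| ≤ C * u ^ (α - 1) := by
  have h1 : (h * ((⌊u / h⌋₊ : ℝ) + 1)) ^ (α - 1) ≤ u ^ (α - 1) :=
    Real.rpow_le_rpow_of_nonpos hu (lt_mul_floor_add_one hh u).le (by linarith [hα.2])
  have h0 := (fracCoeff_pos hα.1 ⌊u / h⌋₊).le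
  have h2 := hC ⌊u / h⌋₊
  rw [approxKernel_eq hh, abs_of_nonneg (by positivity)]
  have : 0 ≤ C := le_trans (by positivity) h2
  gcongr

theorem measurable_rlKernel (α : ℝ) : Measurable (rlKernel α) := by
  unfold rlKernel; fun_prop

theorem measurable_approxKernel (α h : ℝ) : Measurable (approxKernel α h) := by
  unfold approxKernel
  exact ((measurable_of_countable (fracCoeff α)).comp
    (Nat.measurable_floor.comp (measurable_id.div_const h))).const_mul _

theorem abs_rlKernel_eq (hα : 0 < α) {u : ℝ} (hu : 0 < u) :
    |rlKernel α u| = 1 / Real.Gamma α * u ^ (α - 1) := by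
  have := Real.Gamma_pos_of_pos hα
  rw [rlKernel, one_div (u ^ _), ← Real.rpow_neg hu.le, neg_sub, abs_of_nonneg (by positivity)]

theorem intervalIntegrable_of_abs_le_rpow (hT : 0 ≤ T) (hα : 0 < α) {k : ℝ → ℝ} {C : ℝ}
    (hk : Measurable k) (h : ∀ u, 0 < u → |k u| ≤ C * u ^ (α - 1)) :
    IntervalIntegrable k volume 0 T := by
  have h1 : IntervalIntegrable (fun u : ℝ => C * u ^ (α - 1)) volume 0 T :=
    (intervalIntegral.intervalIntegrable_rpow' (by linarith)).const_mul C
  refine h1.mono_fun' hk.aestronglyMeasurable ?_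
  rw [uIoc_of_le hT]
  filter_upwards [ae_restrict_mem measurableSet_Ioc] with u hu using h u hu.1

theorem intervalIntegrable_rlKernel (hT : 0 ≤ T) (hα : 0 < α) :
    IntervalIntegrable (rlKernel α) volume 0 T :=
  intervalIntegrable_of_abs_le_rpow hT hα (measurable_rlKernel α)
    fun _ hu => (abs_rlKernel_eq hα hu).le

theorem intervalIntegrable_approxKernel (hT : 0 ≤ T) (hα : α ∈ Ioo (0 : ℝ) 1) {h : ℝ}
    (hh : 0 < h) : IntervalIntegrable (approxKernel α h) volume 0 T := by
  obtain ⟨C, -, hC⟩ := exists_fracCoeff_le hα.1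
  exact intervalIntegrable_of_abs_le_rpow hT hα.1 (measurable_approxKernel α h)
    fun u hu => abs_approxKernel_le hα hC hh hu

/-- Dominated convergence: both kernels are bounded, uniformly in `h`, by a multiple of `u^(α-1)`,
integrable at 0 because `α > 0`. -/
theorem tendsto_integral_abs_rlKernel_sub (hT : 0 ≤ T) (hα : α ∈ Ioo (0 : ℝ) 1) :
    Tendsto (fun h => ∫ u in (0 : ℝ)..T, |rlKernel α u - approxKernel α h u|) (𝓝[>] 0)
      (𝓝 0) := by
  obtain ⟨C, -, hC⟩ := exists_fracCoeff_le hα.1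
  suffices h : Tendsto _ _ (𝓝 (∫ u in (0 : ℝ)..T, (0 : ℝ))) by
    rwa [intervalIntegral.integral_zero] at h
  refine intervalIntegral.tendsto_integral_filter_of_dominated_convergence
    (fun u => (1 / Real.Gamma α + C) * u ^ (α - 1)) ?_ ?_ ?_ ?_
  · exact Eventually.of_forall fun h =>
      ((measurable_rlKernel α).sub (measurable_approxKernel α h)).abs.aestronglyMeasurable
  · filter_upwards [self_mem_nhdsWithin] with h hh
    refine Eventually.of_forall fun u hu => ?_
    rw [uIoc_of_le hT] at hu
    rw [Real.norm_eq_abs, abs_abs, add_mul, ← abs_rlKernel_eq hα.1 hu.1]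
    exact (abs_sub _ _).trans (by gcongr; exact abs_approxKernel_le hα hC hh hu.1)
  · exact (intervalIntegral.intervalIntegrable_rpow' (by linarith [hα.1])).const_mul _
  · refine Eventually.of_forall fun u hu => ?_
    rw [uIoc_of_le hT] at hu
    have := ((tendsto_approxKernel hα.1 hu.1).const_sub (rlKernel α u)).abs
    simpa using this

theorem tendsto_integral_abs_mul_exp (hT : 0 ≤ T) {k : ℝ → ℝ}
    (hk : IntervalIntegrable k volume 0 T) :
    Tendsto (fun γ : ℝ => ∫ u in (0 : ℝ)..T, |k u| * Real.exp (-γ * u)) atTop (𝓝 0) := by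
  suffices h : Tendsto _ _ (𝓝 (∫ u in (0 : ℝ)..T, (0 : ℝ))) by
    rwa [intervalIntegral.integral_zero] at h
  refine intervalIntegral.tendsto_integral_filter_of_dominated_convergence
    (fun u => |k u|) ?_ ?_ hk.abs ?_
  · refine Eventually.of_forall fun γ => ?_
    rw [uIoc_of_le hT]
    exact hk.abs.1.aestronglyMeasurable.mul
      (by fun_prop : Continuous fun u : ℝ => Real.exp (-γ * u)).aestronglyMeasurable
  · filter_upwards [eventually_ge_atTop 0] with γ hγ
    refine Eventually.of_forall fun u hu => ?_
    rw [uIoc_of_le hT] at hu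
    have : Real.exp (-γ * u) ≤ 1 := Real.exp_le_one_iff.2 (by nlinarith [hu.1])
    rw [Real.norm_eq_abs, abs_mul, abs_abs, abs_of_pos (Real.exp_pos _)]
    exact mul_le_of_le_one_right (abs_nonneg _) this
  · refine Eventually.of_forall fun u hu => ?_
    rw [uIoc_of_le hT] at hu
    have h1 : Tendsto (fun γ : ℝ => -γ * u) atTop atBot :=
      tendsto_neg_atTop_atBot.atBot_mul_const hu.1
    have := (Real.tendsto_exp_atBot.comp h1).const_mul |k u|
    simpa using this

/-- As the weight is at most 1 on `[0, T]`, a `γ` chosen for `k` still works for every kernel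
`L¹`-close to `k`; this makes the weights independent of `h`. -/
theorem integral_abs_mul_exp_le_add {k k' : ℝ → ℝ} {γ : ℝ} (hT : 0 ≤ T) (hγ : 0 ≤ γ)
    (hk : IntervalIntegrable k volume 0 T) (hk' : IntervalIntegrable k' volume 0 T) :
    ∫ u in (0 : ℝ)..T, |k' u| * Real.exp (-γ * u) ≤
      (∫ u in (0 : ℝ)..T, |k u| * Real.exp (-γ * u)) + ∫ u in (0 : ℝ)..T, |k u - k' u| := by
  have hc : ContinuousOn (fun u : ℝ => Real.exp (-γ * u)) (uIcc 0 T) := by fun_prop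
  have h1 := hk.abs.mul_continuousOn hc
  have h2 := (hk.sub hk').abs
  rw [← intervalIntegral.integral_add h1 h2]
  refine intervalIntegral.integral_mono_on hT (hk'.abs.mul_continuousOn hc) (h1.add h2) ?_
  intro u hu
  have he : Real.exp (-γ * u) ≤ 1 := Real.exp_le_one_iff.2 (by nlinarith [hu.1])
  have h3 : |k' u| ≤ |k u| + |k u - k' u| := by
    have := abs_sub (k u) (k u - k' u)
    rwa [sub_sub_cancel] at this
  calc |k' u| * Real.exp (-γ * u) ≤ (|k u| + |k u - k' u|) * Real.exp (-γ * u) := by gcongr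
    _ ≤ |k u| * Real.exp (-γ * u) + |k u - k' u| := by
      nlinarith [abs_nonneg (k u - k' u)]

end Kernels

/-! ### Convolution algebra and the Caputo problem as a Volterra equation -/

section Caputo

variable {E : Type*} [NormedAddCommGroup E] [NormedSpace ℝ E] {α T : ℝ}

theorem volterra_kernel_congr {k k' : ℝ → ℝ} {φ : ℝ → E} {t : ℝ}
    (h : ∀ u ∈ Ioc 0 t, k u = k' u) (ht : 0 ≤ t) : volterra k φ t = volterra k' φ t := by
  unfold volterra
  rw [intervalIntegral.integral_of_le ht, intervalIntegral.integral_of_le ht,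
    -- Dropping the endpoint `s = t` avoids the kernel argument 0, where the hypothesis says
    -- nothing.
    integral_Ioc_eq_integral_Ioo, integral_Ioc_eq_integral_Ioo]
  refine setIntegral_congr_fun measurableSet_Ioo fun s hs => ?_
  rw [h (t - s) ⟨by linarith [hs.2], by linarith [hs.1]⟩]

theorem volterra_eq_integral_indicator {k : ℝ → ℝ} {φ : ℝ → E} {t : ℝ} (ht : t ∈ Icc 0 T) :
    volterra k φ t =
      ∫ s, (Ioc 0 T).indicator k (t - s) • (Ioc 0 T).indicator φ s := by
  rw [volterra, intervalIntegral.integral_of_le ht.1, integral_Ioc_eq_integral_Ioo,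
    ← integral_indicator measurableSet_Ioo]
  refine integral_congr_ae (Eventually.of_forall fun s => ?_)
  simp only
  by_cases hs : s ∈ Ioo 0 t
  · rw [indicator_of_mem hs, indicator_of_mem (show t - s ∈ Ioc 0 T from
      ⟨by linarith [hs.2], by linarith [hs.1, ht.2]⟩), indicator_of_mem (show s ∈ Ioc 0 T from
      ⟨hs.1, hs.2.le.trans ht.2⟩)]
  · rw [indicator_of_notMem hs]
    by_cases h0 : 0 < s
    · rw [indicator_of_notMem (fun h : t - s ∈ Ioc 0 T => hs ⟨h0, by linarith [h.1]⟩), zero_smul]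
    · rw [indicator_of_notMem (fun h : s ∈ Ioc 0 T => h0 h.1), smul_zero]

/-- Associativity of the Volterra convolution. -/
theorem volterra_volterra [CompleteSpace E] {p q : ℝ → ℝ} (hp : IntervalIntegrable p volume 0 T)
    (hq : IntervalIntegrable q volume 0 T) {φ : ℝ → E}
    (hφ : MemLp φ ⊤ (volume.restrict (Icc 0 T))) {t : ℝ} (ht : t ∈ Icc 0 T) :
    volterra p (volterra q φ) t = volterra (volterra p q) φ t := by
  have hT : 0 ≤ T := ht.1.trans ht.2
  rw [intervalIntegrable_iff_integrableOn_Ioc_of_le hT] at hp hq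
  set P := (Ioc 0 T).indicator p with hP
  set Q := (Ioc 0 T).indicator q with hQ
  set Φ := (Ioc 0 T).indicator φ with hΦ
  have hPi : Integrable P := hp.integrable_indicator measurableSet_Ioc
  have hQi : Integrable Q := hq.integrable_indicator measurableSet_Ioc
  have hφ' : MemLp φ ⊤ (volume.restrict (Ioc 0 T)) :=
    hφ.mono_measure (Measure.restrict_mono_set _ Ioc_subset_Icc_self)
  have hΦi : MemLp Φ ⊤ volume := (memLp_indicator_iff_restrict measurableSet_Ioc).2 hφ'
  obtain ⟨C, -, hC⟩ := exists_ae_norm_le_of_memLp_top hΦi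
  -- After extension by zero this is the integrand of a convolution of two integrable functions; the
  -- bounded factor `Φ` does not harm integrability, so Fubini applies.
  have h1 : Integrable (fun x : ℝ × ℝ => P (t - x.2) * Q (x.2 - x.1)) (volume.prod volume) := by
    have := (hPi.comp_sub_left t).convolution_integrand (ContinuousLinearMap.mul ℝ ℝ)
      hQi.comp_neg (μ := volume) (ν := volume)
    simpa using this
  have h2 : Integrable (Function.uncurry fun s τ : ℝ => (P (t - τ) * Q (τ - s)) • Φ s)
      (volume.prod volume) := by
    refine h1.smul_bdd C (f := fun x : ℝ × ℝ => Φ x.1) ?_ ?_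
    · exact hΦi.1.comp_quasiMeasurePreserving Measure.quasiMeasurePreserving_fst
    · exact Measure.quasiMeasurePreserving_fst.ae hC
  have h3 : volterra p (volterra q φ) t = ∫ τ, ∫ s, (P (t - τ) * Q (τ - s)) • Φ s := by
    rw [volterra_eq_integral_indicator ht]
    refine integral_congr_ae (Eventually.of_forall fun τ => ?_)
    simp only [mul_smul]
    rw [integral_smul]
    by_cases hτ : τ ∈ Ioc 0 T
    · rw [indicator_of_mem hτ, volterra_eq_integral_indicator (Ioc_subset_Icc_self hτ)]
    · rw [indicator_of_notMem hτ, smul_zero]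
      by_cases h0 : 0 < τ
      · rw [hP, indicator_of_notMem (fun h : t - τ ∈ Ioc 0 T => hτ ⟨h0, by linarith [h.1, ht.2]⟩),
          zero_smul]
      · rw [integral_eq_zero_of_ae, smul_zero]
        refine Eventually.of_forall fun s => ?_
        by_cases hs : 0 < s
        · simp only
          rw [hQ, indicator_of_notMem (fun h : τ - s ∈ Ioc 0 T => h0 (by linarith [h.1])),
            zero_smul]; rfl
        · simp only
          rw [hΦ, indicator_of_notMem (fun h : s ∈ Ioc 0 T => hs h.1), smul_zero]; rfl
  rw [h3, integral_integral_swap (f := fun τ s => (P (t - τ) * Q (τ - s)) • Φ s) h2.swap,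
    volterra, intervalIntegral.integral_of_le ht.1, ← integral_indicator measurableSet_Ioc]
  refine integral_congr_ae (Eventually.of_forall fun s => ?_)
  simp only
  rw [integral_smul_const]
  by_cases hs : s ∈ Ioc 0 t
  · rw [indicator_of_mem hs, hΦ, indicator_of_mem (show s ∈ Ioc 0 T from ⟨hs.1, hs.2.trans ht.2⟩),
      volterra_eq_integral_indicator (show t - s ∈ Icc 0 T from
        ⟨by linarith [hs.2], by linarith [hs.1, ht.2]⟩)]
    congr 1
    rw [← integral_add_right_eq_self (fun τ => P (t - τ) * Q (τ - s)) s]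
    refine integral_congr_ae (Eventually.of_forall fun v => ?_)
    simp only [smul_eq_mul, add_sub_cancel_right]
    rw [show t - (v + s) = t - s - v by ring]
  · rw [indicator_of_notMem hs]
    by_cases h0 : 0 < s
    · rw [integral_eq_zero_of_ae, zero_smul]
      refine Eventually.of_forall fun τ => ?_
      simp only
      by_cases hτ : τ < t
      · rw [hQ, indicator_of_notMem (fun h : τ - s ∈ Ioc 0 T => hs ⟨h0, by linarith [h.1]⟩),
          mul_zero]; rfl
      · rw [hP, indicator_of_notMem (fun h : t - τ ∈ Ioc 0 T => hτ (by linarith [h.1])),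
          zero_mul]; rfl
    · rw [hΦ, indicator_of_notMem (fun h : s ∈ Ioc 0 T => h0 h.1), smul_zero]

/-- The integral is the Beta integral `B(α, 1-α) = Γ(α)Γ(1-α)/Γ(1)`, whose scaling factor in `u` has
exponent 0. With associativity this is `I^(1-α) I^α = I¹`. -/
theorem volterra_rlKernel_rlKernel (hα : α ∈ Ioo (0 : ℝ) 1) {u : ℝ} (hu : 0 < u) :
    volterra (rlKernel (1 - α)) (rlKernel α) u = 1 := by
  have hΓ := (Real.Gamma_pos_of_pos hα.1).ne'
  have hΓ' := (Real.Gamma_pos_of_pos (sub_pos.2 hα.2)).ne'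
  have h1 : ∫ s in (0 : ℝ)..u, s ^ (α - 1) * (u - s) ^ (-α) =
      Real.Gamma α * Real.Gamma (1 - α) := by
    have hb := Complex.betaIntegral_scaled (α : ℂ) ((1 - α : ℝ) : ℂ) hu
    have hg := Complex.Gamma_mul_Gamma_eq_betaIntegral (s := (α : ℂ)) (t := ((1 - α : ℝ) : ℂ))
      (by simpa using hα.1) (by simpa using hα.2)
    have e : (α : ℂ) + ((1 - α : ℝ) : ℂ) = 1 := by push_cast; ring
    rw [e, Complex.Gamma_one, one_mul, Complex.Gamma_ofReal, Complex.Gamma_ofReal] at hg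
    rw [e, sub_self, Complex.cpow_zero, one_mul, ← hg] at hb
    have : ((∫ s in (0 : ℝ)..u, s ^ (α - 1) * (u - s) ^ (-α) : ℝ) : ℂ) =
        ((Real.Gamma α * Real.Gamma (1 - α) : ℝ) : ℂ) := by
      rw [← intervalIntegral.integral_ofReal]
      push_cast
      rw [← hb]
      refine intervalIntegral.integral_congr fun s hs => ?_
      rw [uIcc_of_le hu.le] at hs
      rw [Complex.ofReal_cpow hs.1, Complex.ofReal_cpow (sub_nonneg.2 hs.2)]
      push_cast
      ring_nf
    exact_mod_cast this
  have h2 : volterra (rlKernel (1 - α)) (rlKernel α) u =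
      ∫ s in (0 : ℝ)..u, (1 / Real.Gamma (1 - α) * (1 / Real.Gamma α)) *
        (s ^ (α - 1) * (u - s) ^ (-α)) := by
    refine intervalIntegral.integral_congr fun s hs => ?_
    rw [uIcc_of_le hu.le] at hs
    simp only [rlKernel, smul_eq_mul]
    rw [one_div (s ^ _), ← Real.rpow_neg hs.1, one_div ((u - s) ^ _),
      ← Real.rpow_neg (sub_nonneg.2 hs.2), neg_sub, neg_sub]
    ring_nf
  rw [h2, intervalIntegral.integral_const_mul, h1]
  field_simp

theorem rlIntegral_eq_volterra (φ : ℝ → E) (t : ℝ) :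
    rlIntegral α φ t = volterra (rlKernel α) φ t := by
  rw [rlIntegral, volterra, ← intervalIntegral.integral_smul]
  simp only [rlKernel, mul_smul]

theorem volterra_rlKernel_volterra_rlKernel [CompleteSpace E] (hα : α ∈ Ioo (0 : ℝ) 1) {φ : ℝ → E}
    (hφ : MemLp φ ⊤ (volume.restrict (Icc 0 T))) {t : ℝ} (ht : t ∈ Icc 0 T) :
    volterra (rlKernel (1 - α)) (volterra (rlKernel α) φ) t = ∫ s in (0 : ℝ)..t, φ s := by
  have hT : 0 ≤ T := ht.1.trans ht.2
  rw [volterra_volterra (intervalIntegrable_rlKernel hT (sub_pos.2 hα.2))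
    (intervalIntegrable_rlKernel hT hα.1) hφ ht,
    volterra_kernel_congr (k' := fun _ => 1)
      (fun u hu => volterra_rlKernel_rlKernel hα hu.1) ht.1]
  simp [volterra]

theorem intervalIntegrable_of_memLp_top {E : Type*} [NormedAddCommGroup E] (hT : 0 ≤ T) {φ : ℝ → E}
    (hφ : MemLp φ ⊤ (volume.restrict (Icc 0 T))) : IntervalIntegrable φ volume 0 T := by
  rw [intervalIntegrable_iff_integrableOn_Icc_of_le hT]
  exact hφ.integrable le_top

theorem ae_hasDerivAt_integral_of_memLp_top [CompleteSpace E] (hT : 0 ≤ T) {φ : ℝ → E}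
    (hφ : MemLp φ ⊤ (volume.restrict (Icc 0 T))) :
    ∀ᵐ t ∂(volume.restrict (Icc 0 T)),
      HasDerivAt (fun s => ∫ τ in (0 : ℝ)..s, φ τ) (φ t) t := by
  rw [ae_restrict_iff' measurableSet_Icc]
  have := (intervalIntegrable_of_memLp_top hT hφ).ae_hasDerivAt_integral
  rw [uIcc_of_le hT] at this
  filter_upwards [this] with t h ht using h ht 0 ⟨le_rfl, hT⟩

theorem ae_restrict_Icc_mem_Ioo : ∀ᵐ t ∂(volume.restrict (Icc 0 T)), t ∈ Ioo 0 T := by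
  rw [Measure.restrict_congr_set Ioo_ae_eq_Icc.symm]
  exact ae_restrict_mem measurableSet_Ioo

/-- The Caputo derivative of `x₀ + I^α φ` is `φ` almost everywhere. -/
theorem ae_hasCaputoDerivAt [CompleteSpace E] (hT : 0 ≤ T) (hα : α ∈ Ioo (0 : ℝ) 1)
    {φ : ℝ → E} (hφ : MemLp φ ⊤ (volume.restrict (Icc 0 T))) {x₀ : E} {x : ℝ → E}
    (hx : ∀ t ∈ Icc 0 T, x t = x₀ + volterra (rlKernel α) φ t) :
    ∀ᵐ t ∂(volume.restrict (Icc 0 T)), HasCaputoDerivAt α x (φ t) t := by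
  have hx0 : x 0 = x₀ := by rw [hx 0 ⟨le_rfl, hT⟩]; simp [volterra]
  filter_upwards [ae_hasDerivAt_integral_of_memLp_top hT hφ, ae_restrict_Icc_mem_Ioo]
    with t ht htm
  refine ht.congr_of_eventuallyEq ?_
  filter_upwards [Ioo_mem_nhds htm.1 htm.2] with s hs
  have hs' := Ioo_subset_Icc_self hs
  have h1 := rlIntegral_eq_volterra (α := 1 - α) (fun τ => x τ - x 0) s
  rw [rlIntegral, sub_sub_cancel] at h1
  rw [h1, ← volterra_rlKernel_volterra_rlKernel hα hφ hs']
  refine volterra_congr_ae (T := T) ?_ hs'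
  filter_upwards [ae_restrict_mem measurableSet_Icc] with τ hτ
  rw [hx τ hτ, hx0, add_sub_cancel_left]

/-- The Caputo derivative of `x₀ + I^α φ` is `φ` a.e., so by uniqueness of derivatives the equation
says exactly `φ = f(·, x(·))` a.e. -/
theorem isCaputoSolution_iff [CompleteSpace E] (hT : 0 ≤ T) (hα : α ∈ Ioo (0 : ℝ) 1)
    {f : ℝ → E → E} {x₀ : E} {x : ℝ → E} :
    IsCaputoSolution α T f x₀ x ↔ IsVolterraSolution (rlKernel α) T f x₀ x := by
  constructor
  · rintro ⟨⟨φ, hφ, hx⟩, hD⟩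
    simp only [rlIntegral_eq_volterra] at hx
    refine ⟨φ, hφ, hx, ?_⟩
    filter_upwards [hD, ae_hasCaputoDerivAt hT hα hφ hx] with t h1 h2
    exact HasDerivAt.unique h2 h1
  · rintro ⟨φ, hφ, hx, hfx⟩
    refine ⟨⟨φ, hφ, by simpa only [rlIntegral_eq_volterra] using hx⟩, ?_⟩
    filter_upwards [hfx, ae_hasCaputoDerivAt hT hα hφ hx] with t h1 h2
    rwa [← h1]

end Caputo

/-! ### The fractional difference problem as a Volterra equation -/

section Approx

variable {E : Type*} [NormedAddCommGroup E] [NormedSpace ℝ E] {α T : ℝ}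

/-- The condition `s ≤ t - jh` reads `j ≤ (t - s)/h`, and as `s > 0` it already implies `j ≤ t/h`;
the surviving terms form a partial sum. -/
theorem sum_binomial_indicator_eq_fracCoeff {h t s : ℝ} (hh : 0 < h) (hs : s ∈ Ioc 0 t) :
    ∑ j ∈ Finset.range (⌊t / h⌋₊ + 1),
      (Iic (t - j * h)).indicator (fun _ => (-1 : ℝ) ^ j * Ring.choose (1 - α) j) s =
    fracCoeff α ⌊(t - s) / h⌋₊ := by
  simp only [indicator_apply]
  rw [← Finset.sum_filter, fracCoeff]
  refine Finset.sum_congr ?_ fun _ _ => rfl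
  ext j
  have hts : 0 ≤ (t - s) / h := div_nonneg (sub_nonneg.2 hs.2) hh.le
  simp only [Finset.mem_filter, Finset.mem_range, Order.lt_add_one_iff, mem_Iic]
  rw [Nat.le_floor_iff hts, Nat.le_floor_iff (div_nonneg (hs.1.le.trans hs.2) hh.le),
    le_div_iff₀ hh, le_div_iff₀ hh]
  constructor
  · rintro ⟨-, h2⟩; linarith
  · intro h1; exact ⟨by linarith [hs.1], by linarith⟩

/-- The scaled fractional difference of `I¹ψ` is a Volterra convolution of `ψ`. -/
theorem fracDiff_integral_eq_volterra {h : ℝ} (hh : 0 < h) {ψ y : ℝ → E}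
    (hψ : MemLp ψ ⊤ (volume.restrict (Icc 0 T)))
    (hy : ∀ t ∈ Icc 0 T, y t = ∫ s in (0 : ℝ)..t, ψ s) {t : ℝ} (ht : t ∈ Icc 0 T) :
    h ^ (α - 1) • fracDiff (1 - α) h y t = volterra (approxKernel α h) ψ t := by
  have hψt : IntegrableOn ψ (Ioc 0 t) :=
    IntegrableOn.mono_set (hψ.integrable le_top) (Ioc_subset_Icc_of_mem ht)
  have hterm : ∀ j ∈ Finset.range (⌊t / h⌋₊ + 1),
      ((-1 : ℝ) ^ j * Ring.choose (1 - α) j) • y (t - j * h) =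
      ∫ s in Ioc 0 t,
        (Iic (t - j * h)).indicator (fun _ => (-1 : ℝ) ^ j * Ring.choose (1 - α) j) s • ψ s := by
    intro j hj
    have hj' : (j : ℝ) * h ≤ t := by
      rw [Finset.mem_range, Order.lt_add_one_iff, Nat.le_floor_iff (div_nonneg ht.1 hh.le),
        le_div_iff₀ hh] at hj
      exact hj
    have hjh : 0 ≤ (j : ℝ) * h := by positivity
    rw [hy _ ⟨by linarith, by linarith [ht.2]⟩, intervalIntegral.integral_of_le (by linarith),
      ← integral_smul]
    have hset : Ioc 0 (t - j * h) = Ioc 0 t ∩ Iic (t - j * h) := by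
      rw [Ioc_inter_Iic, min_eq_right (by linarith)]
    rw [hset, ← setIntegral_indicator measurableSet_Iic]
    refine integral_congr_ae (Eventually.of_forall fun s => ?_)
    simp only [indicator_apply]
    split_ifs <;> simp
  rw [fracDiff, Finset.sum_congr rfl hterm, ← integral_finsetSum, ← integral_smul, volterra,
    intervalIntegral.integral_of_le ht.1]
  · refine setIntegral_congr_fun measurableSet_Ioc fun s hs => ?_
    rw [← Finset.sum_smul, sum_binomial_indicator_eq_fracCoeff hh hs, approxKernel, mul_smul]
  · intro j _
    have := (hψt.smul ((-1 : ℝ) ^ j * Ring.choose (1 - α) j)).indicator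
      (measurableSet_Iic (a := t - (j : ℝ) * h))
    refine Integrable.congr this (Eventually.of_forall fun s => ?_)
    simp only [indicator_apply]
    split_ifs <;> simp

theorem exists_lipschitzOnWith_integral {φ : ℝ → E}
    (hφ : MemLp φ ⊤ (volume.restrict (Icc 0 T))) :
    ∃ L : NNReal, LipschitzOnWith L (fun t => ∫ s in (0 : ℝ)..t, φ s) (Icc 0 T) := by
  obtain ⟨C, hC, hφC⟩ := exists_ae_norm_le_of_memLp_top hφ
  refine ⟨⟨C, hC⟩, LipschitzOnWith.of_dist_le_mul fun a ha b hb => ?_⟩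
  have hint : ∀ t ∈ Icc 0 T, IntervalIntegrable φ volume 0 t := fun t ht =>
    intervalIntegrable_of_memLp_top ht.1
      (hφ.mono_measure (Measure.restrict_mono_set _ (Icc_subset_Icc_right ht.2)))
  rw [dist_eq_norm, intervalIntegral.integral_interval_sub_left (hint a ha) (hint b hb),
    Real.dist_eq]
  refine intervalIntegral.norm_integral_le_of_norm_le_const_ae ?_
  rw [ae_restrict_iff' measurableSet_Icc] at hφC
  filter_upwards [hφC] with s hs hsab
  have := uIoc_subset_uIcc hsab
  exact hs (uIcc_subset_Icc hb ha this)

/-- A Lipschitz function vanishing at `0` is the integral of its derivative. -/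
theorem eq_integral_of_lipschitzOnWith [CompleteSpace E] (hT : 0 ≤ T) {y ψ : ℝ → E}
    {L : NNReal} (hL : LipschitzOnWith L y (Icc 0 T)) (hy0 : y 0 = 0)
    (hψ : MemLp ψ ⊤ (volume.restrict (Icc 0 T)))
    (hD : ∀ᵐ t ∂(volume.restrict (Icc 0 T)), HasDerivAt y (ψ t) t) :
    ∀ t ∈ Icc 0 T, y t = ∫ s in (0 : ℝ)..t, ψ s := by
  obtain ⟨L', hL'⟩ := exists_lipschitzOnWith_integral hψ
  -- The difference is absolutely continuous with zero derivative a.e., hence constant, and it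
  -- vanishes at 0.
  have hac : AbsolutelyContinuousOnInterval (fun t => y t - ∫ s in (0 : ℝ)..t, ψ s) 0 T := by
    refine AbsolutelyContinuousOnInterval.sub ?_ ?_
    · exact LipschitzOnWith.absolutelyContinuousOnInterval (by rwa [uIcc_of_le hT])
    · exact LipschitzOnWith.absolutelyContinuousOnInterval (by rwa [uIcc_of_le hT])
  obtain ⟨C, hC⟩ := hac.const_of_ae_hasDerivAt_zero (by
    rw [uIcc_of_le hT, ← ae_restrict_iff' measurableSet_Icc]
    filter_upwards [hD, ae_hasDerivAt_integral_of_memLp_top hT hψ] with t h1 h2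
    have h3 := h1.sub h2
    rw [sub_self] at h3
    exact h3)
  rw [uIcc_of_le hT] at hC
  have h0 := hC 0 ⟨le_rfl, hT⟩
  simp only [hy0, intervalIntegral.integral_same, sub_zero] at h0
  intro t ht
  have := hC t ht
  rw [← h0] at this
  exact sub_eq_zero.1 this

/-- Nothing is needed from `f`: the right-hand side agrees a.e. with `deriv y`, which is measurable
and bounded by the Lipschitz constant. -/
theorem IsApproxSolution.exists_memLp [CompleteSpace E] [MeasurableSpace E] [BorelSpace E]
    [SecondCountableTopology E] {f : ℝ → E → E} {x₀ : E} {h : ℝ} {y : ℝ → E}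
    (hy : IsApproxSolution α T f x₀ h y) :
    MemLp (fun t => f t (approxState α h x₀ y t)) ⊤ (volume.restrict (Icc 0 T)) := by
  obtain ⟨⟨L, hL⟩, -, hD⟩ := hy
  have hd : MemLp (deriv y) ⊤ (volume.restrict (Icc 0 T)) := by
    refine memLp_top_of_bound (measurable_deriv y).aestronglyMeasurable L ?_
    filter_upwards [ae_restrict_Icc_mem_Ioo] with t ht
    exact norm_deriv_le_of_lipschitzOn (Icc_mem_nhds ht.1 ht.2) hL
  refine (memLp_congr_ae ?_).1 hd
  filter_upwards [hD] with t ht using ht.deriv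

theorem IsApproxSolution.eq_integral [CompleteSpace E] [MeasurableSpace E] [BorelSpace E]
    [SecondCountableTopology E] (hT : 0 ≤ T) {f : ℝ → E → E} {x₀ : E} {h : ℝ} {y : ℝ → E}
    (hy : IsApproxSolution α T f x₀ h y) {t : ℝ} (ht : t ∈ Icc 0 T) :
    y t = ∫ s in (0 : ℝ)..t, f s (approxState α h x₀ y s) := by
  obtain ⟨L, hL⟩ := hy.1
  exact eq_integral_of_lipschitzOnWith hT hL hy.2.1 hy.exists_memLp hy.2.2 t ht

theorem IsApproxSolution.isVolterraSolution [CompleteSpace E] [MeasurableSpace E] [BorelSpace E]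
    [SecondCountableTopology E] (hT : 0 ≤ T) {f : ℝ → E → E} {x₀ : E} {h : ℝ} (hh : 0 < h)
    {y : ℝ → E} (hy : IsApproxSolution α T f x₀ h y) :
    IsVolterraSolution (approxKernel α h) T f x₀ (approxState α h x₀ y) := by
  refine ⟨_, hy.exists_memLp, fun t ht => ?_, EventuallyEq.rfl⟩
  rw [← fracDiff_integral_eq_volterra hh hy.exists_memLp (fun t ht => hy.eq_integral hT ht) ht,
    approxState]

/-- The primitive of `f(·, z(·))` serves as `y`: its scaled fractional difference, shifted by `x₀`,
gives back `z`. -/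
theorem IsVolterraSolution.exists_isApproxSolution [CompleteSpace E] (hT : 0 ≤ T)
    {f : ℝ → E → E} {x₀ : E} {h : ℝ} (hh : 0 < h) {z : ℝ → E}
    (hz : IsVolterraSolution (approxKernel α h) T f x₀ z) :
    ∃ y : ℝ → E, IsApproxSolution α T f x₀ h y := by
  obtain ⟨φ, hφ, hzφ, hfz⟩ := hz
  refine ⟨fun t => ∫ s in (0 : ℝ)..t, φ s, exists_lipschitzOnWith_integral hφ, by simp, ?_⟩
  filter_upwards [hfz, ae_hasDerivAt_integral_of_memLp_top hT hφ,
    ae_restrict_mem measurableSet_Icc] with t h1 h2 ht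
  rw [approxState, fracDiff_integral_eq_volterra hh hφ (fun _ _ => rfl) ht, ← hzφ t ht, ← h1]
  exact h2

end Approx

/-! ### Uniqueness and the main theorem -/

theorem IsVolterraSolution.eqOn {E : Type*} [NormedAddCommGroup E] [NormedSpace ℝ E]
    {k : ℝ → ℝ} {T : ℝ} {f : ℝ → E → E} {x₀ : E} {z w : ℝ → E} {c lam γ r : ℝ}
    (hk : IntervalIntegrable k volume 0 T) (hc : 0 < c)
    (hf : ∀ t ∈ Icc 0 T, ∀ x, ‖f t x‖ ≤ (1 + ‖x‖) * c) (hlam : 0 < lam)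
    (hf_lip : ∀ t ∈ Icc 0 T, ∀ x ∈ Metric.closedBall (0 : E) r,
      ∀ y ∈ Metric.closedBall (0 : E) r, ‖f t x - f t y‖ ≤ lam * ‖x - y‖) (hγ : 0 ≤ γ)
    (hq : ∫ u in (0 : ℝ)..T, |k u| * Real.exp (-γ * u) ≤ 1 / (2 * lam))
    (hz : IsVolterraSolution k T f x₀ z) (hw : IsVolterraSolution k T f x₀ w)
    (hzr : ∀ t ∈ Icc 0 T, ‖z t‖ ≤ r) (hwr : ∀ t ∈ Icc 0 T, ‖w t‖ ≤ r) (hr : 0 ≤ r) :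
    EqOn z w (Icc 0 T) := fun t ht => by
  -- Uniqueness is stability with two equal kernels.
  have := hz.norm_sub_le (η := 0) hk hk hc hf hlam hf_lip hγ hq hw hzr hwr hr (by simp) ht
  rw [mul_zero, mul_zero, zero_mul] at this
  exact sub_eq_zero.1 (norm_le_zero_iff.1 this)

theorem mainTheorem2 (n : ℕ) (α T R₀ : ℝ) (hα : α ∈ Ioo (0 : ℝ) 1) (hT : 0 < T) (hR₀ : 0 < R₀)
    (f : ℝ → EuclideanSpace ℝ (Fin n) → EuclideanSpace ℝ (Fin n))
    (hf_meas : ∀ x, AEMeasurable (fun t => f t x) (volume.restrict (Icc 0 T)))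
    (hf_lip : ∀ r : ℝ, 0 < r → ∃ lam : ℝ, 0 < lam ∧ ∀ t ∈ Icc 0 T,
      ∀ x ∈ Metric.closedBall (0 : EuclideanSpace ℝ (Fin n)) r,
      ∀ y ∈ Metric.closedBall (0 : EuclideanSpace ℝ (Fin n)) r,
        ‖f t x - f t y‖ ≤ lam * ‖x - y‖)
    (hf_growth : ∃ c : ℝ, 0 < c ∧ ∀ t ∈ Icc 0 T, ∀ x, ‖f t x‖ ≤ (1 + ‖x‖) * c) :
    ∀ ε : ℝ, 0 < ε → ∃ hstar : ℝ, 0 < hstar ∧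
      ∀ x₀ ∈ Metric.closedBall (0 : EuclideanSpace ℝ (Fin n)) R₀, ∀ h ∈ Ioc 0 hstar,
        ∃ x y : ℝ → EuclideanSpace ℝ (Fin n),
          (IsCaputoSolution α T f x₀ x ∧
            ∀ x', IsCaputoSolution α T f x₀ x' → EqOn x' x (Icc 0 T)) ∧
          (IsApproxSolution α T f x₀ h y ∧
            ∀ y', IsApproxSolution α T f x₀ h y' → EqOn y' y (Icc 0 T)) ∧
          ∀ t ∈ Icc 0 T, ‖x t - approxState α h x₀ y t‖ ≤ ε := by
  intro ε hε
  obtain ⟨c, hc, hf⟩ := hf_growth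
  have hf_cont : ∀ t ∈ Icc 0 T, Continuous (f t) := fun t ht =>
    continuous_of_lipschitz_on_balls fun r hr => by
      obtain ⟨lam, hlam, h⟩ := hf_lip r hr
      exact ⟨lam, hlam, h t ht⟩
  have hk := intervalIntegrable_rlKernel hT.le hα.1
  have hexists : ∀ δ : ℝ, 0 < δ → ∃ γ : ℝ, 0 ≤ γ ∧
      ∫ u in (0 : ℝ)..T, |rlKernel α u| * Real.exp (-γ * u) ≤ δ := fun δ hδ =>
    ((eventually_ge_atTop 0).and
      ((tendsto_integral_abs_mul_exp hT.le hk).eventually_le_const hδ)).exists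
  -- Only half of the allowance `1/(2c)` is spent on the fractional kernel; the other half pays for
  -- the `L¹` distance to the step kernel. The order matters: `c` fixes `γ`, then the radius `r`,
  -- then `lam`, then `γ'`.
  obtain ⟨γ, hγ, hq⟩ := hexists (1 / (4 * c)) (by positivity)
  set r := 2 * (1 + R₀) * Real.exp (γ * T) with hr
  have hr0 : 0 < r := by positivity
  obtain ⟨lam, hlam, hf_lip⟩ := hf_lip r hr0
  obtain ⟨γ', hγ', hq'⟩ := hexists (1 / (4 * lam)) (by positivity)
  -- The first two terms are the reserved halves; the third makes the stability bound at `t = T` at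
  -- most `ε`.
  set η := min (min (1 / (4 * c)) (1 / (4 * lam)))
    (ε / (2 * ((1 + r) * c) * Real.exp (γ' * T))) with hη
  have hη0 : 0 < η := by positivity
  obtain ⟨hstar, hstar0, hsmall⟩ := mem_nhdsGT_iff_exists_Ioc_subset.1
    ((tendsto_integral_abs_rlKernel_sub hT.le hα).eventually_le_const hη0)
  refine ⟨hstar, hstar0, fun x₀ hx₀ h hh => ?_⟩
  have hx₀' : ‖x₀‖ ≤ R₀ := by simpa using hx₀
  have hkh := intervalIntegrable_approxKernel hT.le hα hh.1
  have hkη : ∫ u in (0 : ℝ)..T, |rlKernel α u - approxKernel α h u| ≤ η := hsmall hh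
  have hη1 : η ≤ 1 / (4 * c) := (min_le_left _ _).trans (min_le_left _ _)
  have hη2 : η ≤ 1 / (4 * lam) := (min_le_left _ _).trans (min_le_right _ _)
  have hη3 : η ≤ ε / (2 * ((1 + r) * c) * Real.exp (γ' * T)) := min_le_right _ _
  have hhalf : ∀ a : ℝ, 0 < a → 1 / (4 * a) + 1 / (4 * a) = 1 / (2 * a) := fun a ha => by
    field_simp; norm_num
  have hpos : ∀ a : ℝ, 0 < a → 0 < 1 / (4 * a) := fun a ha => by positivity
  have hqc : ∫ u in (0 : ℝ)..T, |rlKernel α u| * Real.exp (-γ * u) ≤ 1 / (2 * c) := by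
    linarith [hhalf c hc, hpos c hc]
  have hql : ∫ u in (0 : ℝ)..T, |rlKernel α u| * Real.exp (-γ' * u) ≤ 1 / (2 * lam) := by
    linarith [hhalf lam hlam, hpos lam hlam]
  have hqhc : ∫ u in (0 : ℝ)..T, |approxKernel α h u| * Real.exp (-γ * u) ≤ 1 / (2 * c) := by
    linarith [integral_abs_mul_exp_le_add hT.le hγ hk hkh, hhalf c hc]
  have hqhl : ∫ u in (0 : ℝ)..T, |approxKernel α h u| * Real.exp (-γ' * u) ≤
      1 / (2 * lam) := by
    linarith [integral_abs_mul_exp_le_add hT.le hγ' hk hkh, hhalf lam hlam]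
  have hbound : ∀ {k : ℝ → ℝ}, IntervalIntegrable k volume 0 T →
      ∫ u in (0 : ℝ)..T, |k u| * Real.exp (-γ * u) ≤ 1 / (2 * c) →
      ∀ {z : ℝ → EuclideanSpace ℝ (Fin n)}, IsVolterraSolution k T f x₀ z →
      ∀ t ∈ Icc 0 T, ‖z t‖ ≤ r := fun hki hkq z hz t ht => by
    have h1 := hz.one_add_norm_le hki hc hf hγ hkq hx₀' ht
    have h2 : Real.exp (γ * t) ≤ Real.exp (γ * T) := by gcongr; exact ht.2
    have h3 : 2 * (1 + R₀) * Real.exp (γ * t) ≤ r := by rw [hr]; gcongr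
    linarith
  obtain ⟨x, hx⟩ := exists_isVolterraSolution hk (measurable_rlKernel α) hf_meas hf_cont hc hf hγ
    hqc hx₀' hlam hf_lip hγ' hql
  obtain ⟨z, hz⟩ := exists_isVolterraSolution hkh (measurable_approxKernel α h) hf_meas hf_cont hc
    hf hγ hqhc hx₀' hlam hf_lip hγ' hqhl
  obtain ⟨y, hy⟩ := hz.exists_isApproxSolution hT.le hh.1
  have hyV := hy.isVolterraSolution hT.le hh.1
  refine ⟨x, y, ⟨(isCaputoSolution_iff hT.le hα).2 hx, fun x' hx' => ?_⟩,
    ⟨hy, fun y' hy' t ht => ?_⟩, fun t ht => ?_⟩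
  · have hx'V := (isCaputoSolution_iff hT.le hα).1 hx'
    exact hx'V.eqOn hk hc hf hlam hf_lip hγ' hql hx (hbound hk hqc hx'V) (hbound hk hqc hx) hr0.le
  · have hy'V := hy'.isVolterraSolution hT.le hh.1
    have heq := hy'V.eqOn hkh hc hf hlam hf_lip hγ' hqhl hyV (hbound hkh hqhc hy'V)
      (hbound hkh hqhc hyV) hr0.le
    -- The Volterra equation determines only the approximate states; `y` is recovered as the
    -- integral of `f` along its state.
    rw [hy'.eq_integral hT.le ht, hy.eq_integral hT.le ht]
    refine intervalIntegral.integral_congr fun s hs => ?_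
    rw [uIcc_of_le ht.1] at hs
    rw [heq ⟨hs.1, hs.2.trans ht.2⟩]
  · refine (hx.norm_sub_le hk hkh hc hf hlam hf_lip hγ' hql hyV (hbound hk hqc hx)
      (hbound hkh hqhc hyV) hr0.le hkη ht).trans ?_
    have h2 : Real.exp (γ' * t) ≤ Real.exp (γ' * T) := by gcongr; exact ht.2
    calc 2 * ((1 + r) * c * η) * Real.exp (γ' * t)
        ≤ 2 * ((1 + r) * c * η) * Real.exp (γ' * T) := by gcongr
      _ = η * (2 * ((1 + r) * c) * Real.exp (γ' * T)) := by ring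
      _ ≤ ε := (le_div_iff₀ (by positivity)).1 hη3
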